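/- Let $\mathbb{Z}^*=\mathbb{Z}\setminus\{0\}$, let $F=\langle x,y,z\rangle$ and $\tilde F=\langle\tilde x,\tilde y,\tilde z\rangle$ be free groups of rank $3$, and write $a^b=b^{-1}ab$. Let $\rho,\theta,\tilde\rho,\tilde\theta$ be permutations of $\mathbb{Z}^*$. For $l\in\mathbb{Z}$ and $j\in\mathbb{Z}^*$ put $$v_j^l=(x^jy^{-\rho(j)})^{z^l},\quad w_j^l=(x^jzy^{-\theta(j)})^{z^l},\quad \tilde v_j^l=(\tilde x^j\tilde y^{-\tilde\rho(j)})^{\tilde z^l},\quad \tilde w_j^l=(\tilde x^j\tilde z\tilde y^{-\tilde\theta(j)})^{\tilde z^l},$$ and let $\mathcal S=\{v_j^l,w_j^l\}\subset F$ and $\tilde{\mathcal S}=\{\tilde v_j^l,\tilde w_j^l\}\subset\tilde F$, where $l$ ranges over $\mathbb{Z}$ and $j$ over $\mathbb{Z}^*$. These sets are free bases of the subgroups $H=\langle\mathcal S\rangle\le F$ and $\tilde H=\langle\tilde{\mathcal S}\rangle\le\tilde F$, so every bijection $\iota:\mathcal S\to\tilde{\mathcal S}$ extends to an isomorphism $\iota_*:H\to\tilde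 H$. Let $G=G(\rho,\theta,\tilde\rho,\tilde\theta,\iota)$ be the amalgamated product of $F$ and $\tilde F$ in which $H$ is identified with $\tilde H$ by $\iota_*$, and let $T$ be the Bass–Serre tree of this decomposition: its vertices are the left cosets of $F$ and of $\tilde F$ in $G$, and its edges join $gF$ to $g\tilde F$ for $g\in G$. Then for all $\rho,\theta,\tilde\rho,\tilde\theta$ and $\iota$ the action of $G$ on $T$ is weakly acylindrical. That is, $T$ is a tree, $G$ acts on it without inversions and minimally (no proper nonempty subtree is $G$-invariant), $G$ fixes no point of $T$ and no point of the boundary $\partial T$ (the set of rays of $T$ up to having a common tail), and $G$ does not act 2-transitively on $\partial T$ (the action on ordered pairs of distinct points of $\partial T$ is not transitive). -/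

import Mathlib

/-! ### Actions on simplicial trees -/

namespace TreeAction

variable {V : Type*} {G : Type*} [Group G]

/-- A ray of a graph: an injective one-sided infinite path. (In a tree these are exactly the
one-sided infinite geodesics.) -/
structure Ray (T : SimpleGraph V) where
  toFun : ℕ → V
  adj : ∀ n, T.Adj (toFun n) (toFun (n + 1))
  inj : Function.Injective toFun

/-- Two rays are cofinal if they have a common tail. -/
def Ray.Cofinal {T : SimpleGraph V} (r s : Ray T) : Prop :=
  ∃ m n : ℕ, ∀ k : ℕ, r.toFun (m + k) = s.toFun (n + k)

theorem Ray.Cofinal.trans {T : SimpleGraph V} {r s t : Ray T}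
    (h₁ : r.Cofinal s) (h₂ : s.Cofinal t) : r.Cofinal t := by
  obtain ⟨m, n, h⟩ := h₁
  obtain ⟨p, q, h'⟩ := h₂
  refine ⟨m + p, q + n, fun k => ?_⟩
  have e₁ := h (p + k)
  have e₂ := h' (n + k)
  rw [show m + p + k = m + (p + k) by omega, e₁,
    show n + (p + k) = p + (n + k) by omega, e₂, show q + n + k = q + (n + k) by omega]

/-- Cofinality of rays as an equivalence relation. -/
def raySetoid (T : SimpleGraph V) : Setoid (Ray T) where
  r := Ray.Cofinal
  iseqv :=
    { refl := fun _ => ⟨0, 0, fun _ => rfl⟩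
      symm := fun ⟨m, n, h⟩ => ⟨n, m, fun k => (h k).symm⟩
      trans := Ray.Cofinal.trans }

/-- The boundary `∂T` of a tree `T`: rays up to cofinality. -/
def Boundary (T : SimpleGraph V) : Type _ := Quotient (raySetoid T)

/-- The image of a ray under an automorphism. -/
def Ray.map {T : SimpleGraph V} (φ : T ≃g T) (r : Ray T) : Ray T where
  toFun n := φ (r.toFun n)
  adj n := φ.map_rel_iff.2 (r.adj n)
  inj := φ.injective.comp r.inj

/-- The map of the boundary induced by an automorphism. -/
def Boundary.map {T : SimpleGraph V} (φ : T ≃g T) : Boundary T → Boundary T :=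
  Quotient.map' (Ray.map φ) (fun _ _ ⟨m, n, h⟩ => ⟨m, n, fun k => congrArg φ (h k)⟩)

/-- No element of the group swaps the two ends of an edge. -/
def WithoutInversions {T : SimpleGraph V} (α : G →* (T ≃g T)) : Prop :=
  ∀ (g : G) (u v : V), T.Adj u v → ¬ (α g u = v ∧ α g v = u)

/-- The only nonempty invariant subtree is the whole tree. (A subtree of a tree is the induced
subgraph on its vertex set, so subtrees are given by connected sets of vertices.) -/
def IsMinimal {T : SimpleGraph V} (α : G →* (T ≃g T)) : Prop :=
  ∀ S : Set V, (T.induce S).Connected → (∀ g : G, ∀ v ∈ S, α g v ∈ S) → S = Set.univ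

/-- The action on the boundary is transitive on ordered pairs of distinct points. -/
def IsTwoTransitiveOnBoundary {T : SimpleGraph V} (α : G →* (T ≃g T)) : Prop :=
  ∀ a b c d : Boundary T, a ≠ b → c ≠ d →
    ∃ g : G, Boundary.map (α g) a = c ∧ Boundary.map (α g) b = d

/-- A weakly acylindrical action of a group on a simplicial tree: an action without inversions
on a tree which is minimal, fixes no point (neither of the tree nor of its boundary) and is not
2-transitive on the boundary. Since there are no inversions, fixing a point of the geometric
realisation of the tree amounts to fixing a vertex. -/
structure IsWeaklyAcylindrical {T : SimpleGraph V} (α : G →* (T ≃g T)) : Prop where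
  isTree : T.IsTree
  withoutInversions : WithoutInversions α
  minimal : IsMinimal α
  no_fixed_vertex : ¬ ∃ v : V, ∀ g : G, α g v = v
  no_fixed_end : ¬ ∃ e : Boundary T, ∀ g : G, Boundary.map (α g) e = e
  not_twoTransitive : ¬ IsTwoTransitiveOnBoundary α

/-- The coset graph of two subgroups `A`, `B` of `G`: its vertices are the left cosets of `A`
and the left cosets of `B`, and every `g : G` gives an edge joining `gA` and `gB`. If `G` is the
amalgamated product of `A` and `B` over `A ∩ B`, this is the Bass–Serre tree of the
decomposition (the edges correspond to the left cosets of `A ∩ B`). -/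
def cosetGraph (A B : Subgroup G) : SimpleGraph ((G ⧸ A) ⊕ (G ⧸ B)) where
  Adj u v := ∃ g : G,
    (u = Sum.inl (g : G ⧸ A) ∧ v = Sum.inr (g : G ⧸ B)) ∨
    (v = Sum.inl (g : G ⧸ A) ∧ u = Sum.inr (g : G ⧸ B))
  symm := ⟨fun _ _ ⟨g, h⟩ => ⟨g, h.symm⟩⟩
  loopless := ⟨fun u ⟨g, h⟩ => by
    rcases h with ⟨h₁, h₂⟩ | ⟨h₁, h₂⟩ <;> simp [h₁] at h₂⟩

theorem cosetGraph_adj_smul (A B : Subgroup G) (g : G) {u v : (G ⧸ A) ⊕ (G ⧸ B)}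
    (h : (cosetGraph A B).Adj u v) : (cosetGraph A B).Adj (g • u) (g • v) := by
  obtain ⟨k, ⟨rfl, rfl⟩ | ⟨rfl, rfl⟩⟩ := h
  · exact ⟨g * k, Or.inl ⟨rfl, rfl⟩⟩
  · exact ⟨g * k, Or.inr ⟨rfl, rfl⟩⟩

/-- The action of `G` on the coset graph by left translation. -/
def cosetGraphAction (A B : Subgroup G) : G →* (cosetGraph A B ≃g cosetGraph A B) where
  toFun g :=
    { toEquiv := MulAction.toPerm g
      map_rel_iff' := by
        intro u v
        refine ⟨fun h => ?_, cosetGraph_adj_smul A B g⟩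
        have h' := cosetGraph_adj_smul A B g⁻¹ h
        simpa using h' }
  map_one' := by ext u; exact one_smul G u
  map_mul' g k := by ext u; exact mul_smul g k u

end TreeAction

/-! ### The groups `G(ρ, θ, ρ', θ', ι)` -/

namespace Camm

/-- `ℤ* = ℤ ∖ {0}`. -/
abbrev ZStar : Type := {n : ℤ // n ≠ 0}

/-- The free group of rank three. -/
abbrev F₃ : Type := FreeGroup (Fin 3)

/-- The first free generator. -/
def x : F₃ := FreeGroup.of 0

/-- The second free generator. -/
def y : F₃ := FreeGroup.of 1

/-- The third free generator. -/
def z : F₃ := FreeGroup.of 2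

/-- `v_j^l = (x^j y^{-ρ(j)})^{z^l}`, where `a^b = b⁻¹ a b`. -/
def v (ρ : Equiv.Perm ZStar) (l : ℤ) (j : ZStar) : F₃ :=
  (z ^ l)⁻¹ * (x ^ (j : ℤ) * y ^ (-(ρ j : ℤ))) * z ^ l

/-- `w_j^l = (x^j z y^{-θ(j)})^{z^l}`, where `a^b = b⁻¹ a b`. -/
def w (θ : Equiv.Perm ZStar) (l : ℤ) (j : ZStar) : F₃ :=
  (z ^ l)⁻¹ * (x ^ (j : ℤ) * z * y ^ (-(θ j : ℤ))) * z ^ l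

/-- The set `𝒮 = {v_j^l} ∪ {w_j^l}`, a free basis of the subgroup `H` it generates. -/
def genSet (ρ θ : Equiv.Perm ZStar) : Set F₃ :=
  {a | ∃ (l : ℤ) (j : ZStar), a = v ρ l j} ∪ {a | ∃ (l : ℤ) (j : ZStar), a = w θ l j}

/-- The two homomorphisms from the free group on `𝒮` to the two copies of `F₃`: the first is
induced by the inclusion of `𝒮` and has image `H = ⟨𝒮⟩`, the second is induced by `ι` and has
image `H' = ⟨𝒮'⟩`. As `𝒮` and `𝒮'` are free bases, these are the isomorphism of the free group
on `𝒮` with `H`, and its composition with the isomorphism `ι* : H → H'` that extends `ι`. -/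
def legs {ρ θ ρ' θ' : Equiv.Perm ZStar} (ι : genSet ρ θ ≃ genSet ρ' θ') :
    Fin 2 → (FreeGroup (genSet ρ θ) →* F₃) :=
  ![FreeGroup.lift (fun s => (s : F₃)), FreeGroup.lift (fun s => (ι s : F₃))]

/-- The group `G(ρ, θ, ρ', θ', ι)`: the amalgamated product of two copies of `F₃` in which
`H` and `H'` are identified by `ι*`, that is, every `s ∈ 𝒮` is identified with `ι s ∈ 𝒮'`. -/
abbrev GroupG {ρ θ ρ' θ' : Equiv.Perm ZStar} (ι : genSet ρ θ ≃ genSet ρ' θ') : Type :=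
  Monoid.PushoutI (G := fun _ : Fin 2 => F₃) (legs ι)

/-- The image in `G(ρ, θ, ρ', θ', ι)` of one of the two free factors. -/
def factor {ρ θ ρ' θ' : Equiv.Perm ZStar} (ι : genSet ρ θ ≃ genSet ρ' θ') (i : Fin 2) :
    Subgroup (GroupG ι) :=
  (Monoid.PushoutI.of (G := fun _ : Fin 2 => F₃) (φ := legs ι) i).range

/-- The action of `G(ρ, θ, ρ', θ', ι)` on the Bass–Serre tree of its decomposition as an
amalgamated product. -/
def bassSerreAction {ρ θ ρ' θ' : Equiv.Perm ZStar} (ι : genSet ρ θ ≃ genSet ρ' θ') :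
    GroupG ι →* (TreeAction.cosetGraph (factor ι 0) (factor ι 1) ≃g
      TreeAction.cosetGraph (factor ι 0) (factor ι 1)) :=
  TreeAction.cosetGraphAction (factor ι 0) (factor ι 1)

end Camm

/-! Write `A`, `B` for the two factors and `H = A ∩ B`. The coset graph is a tree by the normal form
theorem for amalgams, which is used only through the last letter of a reduced expression
(`LastLetter`). The two generators `z`, one in `A ∖ H` and one in `B ∖ H`, give minimality and
exclude fixed vertices and fixed ends.

Against 2-transitivity, compare two rays from the vertex `A`: one obtained by multiplying
alternately by the two `z`, the other with `x ∈ A` replacing the first `z`. Conjugation by `z`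
raises the superscript `l` of each generator by one, so it maps `H` into itself in both factors, and
an element fixing an edge of the first ray fixes everything beyond it (`axisVertex_fixed`). But `x`
does not normalise `H`, so arbitrarily far along the second ray some element fixes an edge and moves
the next vertex. Hence no group element carries the end of the first ray to that of the second
(`LastLetter.isWeaklyAcylindrical`).

The facts about `H` come from an action of `F₃` on `FreeGroup Label × ℤ × ℤ` (`reading`). Over the
base point `(0, 0)` every element of `𝒮` fixes the integer coordinates and multiplies the first
coordinate by its own label. This proves that `𝒮` is free, and an element that moves the base point
lies outside `H`. -/

namespace TreeAction

/-! ### Distances, rays and ends in trees. -/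

section Tree

variable {V : Type*} {T : SimpleGraph V}

/-- In a tree, a vertex has at most one neighbour that is closer to a given vertex. -/
theorem eq_of_dist_lt (hT : T.IsTree) {p v u w : V} (hu : T.Adj v u) (hw : T.Adj v w)
    (hdu : T.dist p u < T.dist p v) (hdw : T.dist p w < T.dist p v) : u = w := by
  classical
  obtain ⟨P, hP, -⟩ := hT.connected.exists_path_of_dist p v
  -- A geodesic from `p` to such a neighbour is too short to meet `v`, so the unique path to `v`
  -- runs through the neighbour just before `v`.
  have key : ∀ u, T.Adj v u → T.dist p u < T.dist p v → u = P.penultimate := by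
    intro u hu hdu
    obtain ⟨q, hq, hlen⟩ := hT.connected.exists_path_of_dist p u
    have hv : v ∉ q.support := fun hv => by
      have := SimpleGraph.dist_le (q.takeUntil v hv)
      have := q.length_takeUntil_le_length hv
      omega
    exact hT.isAcyclic.eq_penultimate_of_adj_end hP hu
      (hT.isAcyclic.mem_support_of_ne_mem_support_of_adj_of_isPath hP hq hu hv)
  rw [key u hu hdu, key w hw hdw]

/-- A connected set of vertices of a tree that contains two neighbours of a vertex contains
this vertex. -/
theorem mem_of_adj_of_adj (hT : T.IsTree) {S : Set V} (hS : (T.induce S).Connected) {u v w : V}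
    (hu : u ∈ S) (hw : w ∈ S) (hne : u ≠ w) (huv : T.Adj u v) (hvw : T.Adj v w) : v ∈ S := by
  classical
  obtain ⟨p, hp, -⟩ := hS.exists_path_of_dist ⟨u, hu⟩ ⟨w, hw⟩
  let f : T.induce S →g T := (SimpleGraph.Embedding.induce S).toHom
  have hf : Function.Injective f := Subtype.val_injective
  have hq : (p.map f).IsPath := (SimpleGraph.Walk.isPath_map_iff_of_injective hf).2 hp
  have hr : (SimpleGraph.Walk.cons huv (SimpleGraph.Walk.cons hvw .nil)).IsPath := by
    simp [SimpleGraph.Walk.cons_isPath_iff, huv.ne, hvw.ne, hne]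
  have heq := congrArg Subtype.val
    ((hT.isAcyclic.subsingleton_path u w).elim ⟨p.map f, hq⟩ ⟨_, hr⟩)
  have hv : v ∈ (p.map f).support := by
    change p.map f = _ at heq
    rw [heq]
    exact List.mem_cons_of_mem _ List.mem_cons_self
  rw [SimpleGraph.Walk.support_map] at hv
  obtain ⟨s, -, hs⟩ := List.mem_map.1 hv
  exact hs ▸ s.2

theorem dist_map_le (φ : T ≃g T) (hT : T.Connected) (u v : V) :
    T.dist (φ u) (φ v) ≤ T.dist u v := by
  obtain ⟨p, hp⟩ := hT.exists_walk_length_eq_dist u v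
  rw [← hp, ← SimpleGraph.Walk.length_map φ.toHom p]
  exact SimpleGraph.dist_le _

theorem dist_map (φ : T ≃g T) (hT : T.Connected) (u v : V) :
    T.dist (φ u) (φ v) = T.dist u v := by
  refine le_antisymm (dist_map_le φ hT u v) ?_
  simpa using dist_map_le φ.symm hT (φ u) (φ v)

/-- The distance from a fixed vertex to a vertex running through a ray is eventually
increasing. -/
theorem Ray.exists_dist_add (hT : T.IsTree) (r : Ray T) (p : V) (m : ℕ) :
    ∃ N, m ≤ N ∧ ∀ k, T.dist p (r.toFun (N + k)) = T.dist p (r.toFun N) + k := by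
  obtain ⟨N, hmN, hN⟩ : ∃ N, m ≤ N ∧
      T.dist p (r.toFun (N + 1)) = T.dist p (r.toFun N) + 1 := by
    -- Distances to adjacent vertices differ by exactly one, so a distance that never rose would
    -- fall at every step and become negative.
    by_contra! h
    have : ∀ k, T.dist p (r.toFun (m + k)) + k = T.dist p (r.toFun m) := by
      intro k
      induction k with
      | zero => rfl
      | succ k ih =>
        have h1 := h (m + k) (by omega)
        have h2 := hT.dist_eq_dist_add_one_of_adj p (r.adj (m + k))
        rw [add_assoc] at h1 h2
        omega
    have := this (T.dist p (r.toFun m) + 1)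
    omega
  refine ⟨N, hmN, fun k => ?_⟩
  have key : ∀ k, T.dist p (r.toFun (N + k)) = T.dist p (r.toFun N) + k ∧
      T.dist p (r.toFun (N + k + 1)) = T.dist p (r.toFun N) + (k + 1) := by
    intro k
    induction k with
    | zero => exact ⟨rfl, hN⟩
    | succ k ih =>
      refine ⟨ih.2, ?_⟩
      rcases hT.dist_eq_dist_add_one_of_adj p (r.adj (N + k + 1)) with h | h
      -- A fall after a rise would give the middle vertex two nearer neighbours; these coincide, and
      -- the ray would backtrack.
      · have := r.inj (eq_of_dist_lt hT (r.adj (N + k)).symm (r.adj (N + k + 1))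
          (by omega : T.dist p _ < T.dist p _) (by omega))
        omega
      · have := ih.2
        rw [← add_assoc]
        omega
  exact (key k).1

/-- An automorphism of a tree that fixes a vertex and the end of a ray fixes a tail of the ray
pointwise. -/
theorem Ray.exists_fixed_tail (hT : T.IsTree) (φ : T ≃g T) {p : V} (hp : φ p = p) {r : Ray T}
    (h : (r.map φ).Cofinal r) : ∃ N, ∀ k, φ (r.toFun (N + k)) = r.toFun (N + k) := by
  obtain ⟨m, n, hmn⟩ := h
  change ∀ k, φ (r.toFun (m + k)) = r.toFun (n + k) at hmn
  obtain ⟨N, hN, hd⟩ := r.exists_dist_add hT p (m + n)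
  have h1 : T.dist p (r.toFun (m + N)) = T.dist p (r.toFun (n + N)) := by
    rw [← hmn, ← dist_map φ hT.connected p, hp]
  have hm := hd m
  have hn := hd n
  rw [add_comm] at hm hn
  obtain rfl : m = n := by omega
  exact ⟨m, hmn⟩

end Tree

/-! ### The coset graph of an amalgamated product is a tree. -/

section CosetGraph

variable {G : Type*} [Group G] {A B : Subgroup G}

/-- Two sets of elements of a group which behave as the sets of elements of an amalgamated
product `A *_{A ∩ B} B` whose reduced expressions end with a letter from `A`, respectively from
`B`. -/
structure LastLetter (A B : Subgroup G) (PA PB : Set G) : Prop where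
  disj : ∀ g ∈ PA, g ∉ PB
  notMem_left : ∀ a ∈ A, a ∉ PB
  notMem_right : ∀ b ∈ B, b ∉ PA
  mul_left : ∀ g ∉ PA, ∀ a ∈ A, a ∉ B → g * a ∈ PA
  mul_right : ∀ g ∉ PB, ∀ b ∈ B, b ∉ A → g * b ∈ PB

theorem LastLetter.symm {PA PB : Set G} (h : LastLetter A B PA PB) : LastLetter B A PB PA :=
  ⟨fun g hg hg' => h.disj g hg' hg, h.notMem_right, h.notMem_left, h.mul_right, h.mul_left⟩

theorem LastLetter.pow_mem {PA PB : Set G} (h : LastLetter A B PA PB) {a b : G}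
    (ha : a ∈ A) (ha' : a ∉ B) (hb : b ∈ B) (hb' : b ∉ A) (k : ℕ) : (a * b) ^ (k + 1) ∈ PB := by
  have step : ∀ g ∉ PA, g * (a * b) ∈ PB := fun g hg => by
    rw [← mul_assoc]
    exact h.mul_right _ (h.disj _ (h.mul_left g hg a ha ha')) b hb hb'
  induction k with
  | zero =>
    rw [zero_add, pow_one]
    simpa using step 1 (h.notMem_right 1 B.one_mem)
  | succ k ih =>
    rw [pow_succ]
    exact step _ fun hg => h.disj _ hg ih

theorem cosetGraph_adj_inl {g : G} {v : (G ⧸ A) ⊕ (G ⧸ B)}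
    (h : (cosetGraph A B).Adj (Sum.inl (g : G ⧸ A)) v) :
    ∃ a ∈ A, v = Sum.inr ((g * a : G) : G ⧸ B) := by
  obtain ⟨k, ⟨h1, rfl⟩ | ⟨-, h2⟩⟩ := h
  · exact ⟨g⁻¹ * k, QuotientGroup.eq.1 (Sum.inl.inj h1), by simp⟩
  · cases h2

theorem cosetGraph_adj_inr {g : G} {v : (G ⧸ A) ⊕ (G ⧸ B)}
    (h : (cosetGraph A B).Adj (Sum.inr (g : G ⧸ B)) v) :
    ∃ b ∈ B, v = Sum.inl ((g * b : G) : G ⧸ A) := by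
  obtain ⟨k, ⟨h2, -⟩ | ⟨rfl, h1⟩⟩ := h
  · cases h2
  · exact ⟨g⁻¹ * k, QuotientGroup.eq.1 (Sum.inr.inj h1), by simp⟩

theorem inl_mul_mem (g : G) {a : G} (ha : a ∈ A) :
    (Sum.inl ((g * a : G) : G ⧸ A) : (G ⧸ A) ⊕ (G ⧸ B)) = Sum.inl (g : G ⧸ A) :=
  congrArg _ (QuotientGroup.mk_mul_of_mem g ha)

theorem inr_mul_mem (g : G) {b : G} (hb : b ∈ B) :
    (Sum.inr ((g * b : G) : G ⧸ B) : (G ⧸ A) ⊕ (G ⧸ B)) = Sum.inr (g : G ⧸ B) :=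
  congrArg _ (QuotientGroup.mk_mul_of_mem g hb)

theorem inl_eq_inl_iff {g k : G} :
    (Sum.inl (g : G ⧸ A) : (G ⧸ A) ⊕ (G ⧸ B)) = Sum.inl (k : G ⧸ A) ↔ g⁻¹ * k ∈ A :=
  Sum.inl_injective.eq_iff.trans QuotientGroup.eq

theorem inr_eq_inr_iff {g k : G} :
    (Sum.inr (g : G ⧸ B) : (G ⧸ A) ⊕ (G ⧸ B)) = Sum.inr (k : G ⧸ B) ↔ g⁻¹ * k ∈ B :=
  Sum.inr_injective.eq_iff.trans QuotientGroup.eq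

theorem cosetGraph_adj (g : G) :
    (cosetGraph A B).Adj (Sum.inl (g : G ⧸ A)) (Sum.inr (g : G ⧸ B)) :=
  ⟨g, Or.inl ⟨rfl, rfl⟩⟩

theorem cosetGraph_connected (hgen : A ⊔ B = ⊤) : (cosetGraph A B).Connected := by
  have hr : ∀ g : G, (cosetGraph A B).Reachable (Sum.inl ((1 : G) : G ⧸ A))
      (Sum.inl (g : G ⧸ A)) := by
    intro g
    have hg : g ∈ Subgroup.closure ((A : Set G) ∪ B) := by
      rw [Subgroup.closure_union, Subgroup.closure_eq, Subgroup.closure_eq, hgen]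
      trivial
    induction hg using Subgroup.closure_induction_right with
    | one => exact .refl _
    | mul_right k _ l hl ih =>
      rcases hl with hl | hl
      · rwa [inl_mul_mem k hl]
      · refine (ih.trans (cosetGraph_adj k).reachable).trans ?_
        rw [← inr_mul_mem k hl]
        exact (cosetGraph_adj _).symm.reachable
    | mul_inv_cancel k _ l hl ih =>
      rcases hl with hl | hl
      · rwa [inl_mul_mem k (A.inv_mem hl)]
      · refine (ih.trans (cosetGraph_adj k).reachable).trans ?_
        rw [← inr_mul_mem k (B.inv_mem hl)]
        exact (cosetGraph_adj _).symm.reachable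
  have hr' : ∀ v, (cosetGraph A B).Reachable (Sum.inl ((1 : G) : G ⧸ A)) v := by
    rintro (v | v) <;> obtain ⟨g, rfl⟩ := QuotientGroup.mk_surjective v
    · exact hr g
    · exact (hr g).trans (cosetGraph_adj g).reachable
  have : Nonempty ((G ⧸ A) ⊕ (G ⧸ B)) := ⟨Sum.inl ((1 : G) : G ⧸ A)⟩
  exact ⟨fun u v => (hr' u).symm.trans (hr' v)⟩

/-- If a trail starts by moving away from the base edge, then it ends at a vertex different
from both ends of the base edge. -/
theorem LastLetter.trail {PA PB : Set G} (h : LastLetter A B PA PB) {v w : (G ⧸ A) ⊕ (G ⧸ B)}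
    (p : (cosetGraph A B).Walk v w) (hp : p.IsTrail) (u : (G ⧸ A) ⊕ (G ⧸ B))
    (huv : s(u, v) ∉ p.edges)
    (hout : ∃ g : G, (u = Sum.inl (g : G ⧸ A) ∧ v = Sum.inr (g : G ⧸ B) ∧ g ∉ PB) ∨
      (u = Sum.inr (g : G ⧸ B) ∧ v = Sum.inl (g : G ⧸ A) ∧ g ∉ PA)) :
    v = w ∨ ∃ g : G, (w = Sum.inr (g : G ⧸ B) ∧ g ∈ PA) ∨ (w = Sum.inl (g : G ⧸ A) ∧ g ∈ PB) := by
  induction p generalizing u with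
  | nil => exact Or.inl rfl
  | @cons v v' w hadj p ih =>
    rw [SimpleGraph.Walk.isTrail_cons] at hp
    -- A trail does not turn back, so the letter appended at this step lies outside `A ∩ B` and
    -- becomes the new last letter.
    have hne : v' ≠ u := by
      rintro rfl
      exact huv (by simp [Sym2.eq_swap])
    have hout' : ∃ g : G, (v = Sum.inl (g : G ⧸ A) ∧ v' = Sum.inr (g : G ⧸ B) ∧ g ∈ PA) ∨
      (v = Sum.inr (g : G ⧸ B) ∧ v' = Sum.inl (g : G ⧸ A) ∧ g ∈ PB) := by
      obtain ⟨g, ⟨rfl, rfl, hg⟩ | ⟨rfl, rfl, hg⟩⟩ := hout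
      · obtain ⟨b, hb, rfl⟩ := cosetGraph_adj_inr hadj
        exact ⟨g * b, Or.inr ⟨(inr_mul_mem g hb).symm, rfl,
          h.mul_right g hg b hb fun hb' => hne (inl_mul_mem g hb')⟩⟩
      · obtain ⟨a, ha, rfl⟩ := cosetGraph_adj_inl hadj
        exact ⟨g * a, Or.inl ⟨(inl_mul_mem g ha).symm, rfl,
          h.mul_left g hg a ha fun ha' => hne (inr_mul_mem g ha')⟩⟩
    refine Or.inr ?_
    obtain ⟨g, hg⟩ := hout'
    rcases ih hp.1 v hp.2 ⟨g, hg.imp (fun ⟨h1, h2, h3⟩ => ⟨h1, h2, h.disj g h3⟩)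
      (fun ⟨h1, h2, h3⟩ => ⟨h1, h2, h.symm.disj g h3⟩)⟩ with rfl | h'
    · exact ⟨g, hg.imp And.right And.right⟩
    · exact h'

/-- By homogeneity a cycle may be based at the vertex `A` or `B`. After its first edge it is a trail
leaving the base edge, so by `LastLetter.trail` it cannot end at its starting point. -/
theorem LastLetter.isAcyclic {PA PB : Set G} (h : LastLetter A B PA PB) :
    (cosetGraph A B).IsAcyclic := by
  have key : ∀ (v : (G ⧸ A) ⊕ (G ⧸ B)) (c : (cosetGraph A B).Walk v v),
      (v = Sum.inl ((1 : G) : G ⧸ A) ∨ v = Sum.inr ((1 : G) : G ⧸ B)) → ¬ c.IsCycle := by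
    intro v c hv hc
    cases c with
    | nil => exact hc.not_nil .nil
    | @cons _ v' _ hadj p =>
      rw [SimpleGraph.Walk.cons_isCycle_iff] at hc
      obtain ⟨hp, he⟩ := hc
      rcases hv with rfl | rfl
      · obtain ⟨a, ha, rfl⟩ := cosetGraph_adj_inl hadj
        rcases h.trail p hp.isTrail _ he ⟨1 * a, Or.inl ⟨(inl_mul_mem 1 ha).symm,
          rfl, h.notMem_left _ (A.mul_mem A.one_mem ha)⟩⟩ with h' | ⟨g, ⟨h', -⟩ | ⟨h', hg⟩⟩
        · cases h'
        · cases h'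
        · rw [inl_eq_inl_iff, inv_one, one_mul] at h'
          exact h.notMem_left g h' hg
      · obtain ⟨b, hb, rfl⟩ := cosetGraph_adj_inr hadj
        rcases h.trail p hp.isTrail _ he ⟨1 * b, Or.inr ⟨(inr_mul_mem 1 hb).symm,
          rfl, h.notMem_right _ (B.mul_mem B.one_mem hb)⟩⟩ with h' | ⟨g, ⟨h', hg⟩ | ⟨h', -⟩⟩
        · cases h'
        · rw [inr_eq_inr_iff, inv_one, one_mul] at h'
          exact h.notMem_right g h' hg
        · cases h'
  intro v c hc
  obtain ⟨g, hg⟩ : ∃ g : G, g • v = Sum.inl ((1 : G) : G ⧸ A) ∨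
      g • v = Sum.inr ((1 : G) : G ⧸ B) := by
    rcases v with v | v <;> obtain ⟨g, rfl⟩ := QuotientGroup.mk_surjective v
    · exact ⟨g⁻¹, Or.inl (congrArg (fun k : G => Sum.inl (k : G ⧸ A)) (inv_mul_cancel g))⟩
    · exact ⟨g⁻¹, Or.inr (congrArg (fun k : G => Sum.inr (k : G ⧸ B)) (inv_mul_cancel g))⟩
  exact key _ (c.map (cosetGraphAction A B g).toHom) hg
    (hc.map (cosetGraphAction A B g).injective)

theorem LastLetter.isTree {PA PB : Set G} (h : LastLetter A B PA PB) (hgen : A ⊔ B = ⊤) :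
    (cosetGraph A B).IsTree :=
  ⟨cosetGraph_connected hgen, h.isAcyclic⟩

end CosetGraph

end TreeAction

namespace TreeAction

/-! ### Weak acylindricity of the action on the coset graph. -/

section CosetGraph

variable {G : Type*} [Group G] {A B : Subgroup G}

theorem cosetGraphAction_withoutInversions (A B : Subgroup G) :
    WithoutInversions (cosetGraphAction A B) := by
  rintro g u v ⟨k, ⟨rfl, rfl⟩ | ⟨rfl, rfl⟩⟩ ⟨h, -⟩ <;> cases h

theorem cosetGraphAction_inl (g k : G) :
    cosetGraphAction A B g (Sum.inl (k : G ⧸ A)) = Sum.inl ((g * k : G) : G ⧸ A) := rfl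

theorem cosetGraphAction_inr (g k : G) :
    cosetGraphAction A B g (Sum.inr (k : G ⧸ B)) = Sum.inr ((g * k : G) : G ⧸ B) := rfl

/-- The group is transitive on each kind of vertex, and `gB` is the midpoint between the distinct
vertices `gA` and `gbA`, as `gA` is between `gB` and `gaB`. So an invariant subtree with vertices of
one kind contains both kinds. -/
theorem cosetGraphAction_isMinimal (hT : (cosetGraph A B).IsTree) {a b : G} (ha : a ∈ A)
    (ha' : a ∉ B) (hb : b ∈ B) (hb' : b ∉ A) : IsMinimal (cosetGraphAction A B) := by
  intro S hS hinv
  obtain ⟨⟨s, hs⟩⟩ := hS.nonempty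
  have trl : ∀ g k : G, Sum.inl (g : G ⧸ A) ∈ S → Sum.inl (k : G ⧸ A) ∈ S := fun g k hg => by
    have := hinv (k * g⁻¹) _ hg
    rwa [cosetGraphAction_inl, inv_mul_cancel_right] at this
  have trr : ∀ g k : G, Sum.inr (g : G ⧸ B) ∈ S → Sum.inr (k : G ⧸ B) ∈ S := fun g k hg => by
    have := hinv (k * g⁻¹) _ hg
    rwa [cosetGraphAction_inr, inv_mul_cancel_right] at this
  have hlr : ∀ g : G, Sum.inl (g : G ⧸ A) ∈ S → Sum.inr (g : G ⧸ B) ∈ S := by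
    intro g hg
    refine mem_of_adj_of_adj hT hS hg (trl g (g * b) hg) ?_ (cosetGraph_adj g) ?_
    · rw [Ne, inl_eq_inl_iff]
      simpa using hb'
    · rw [← inr_mul_mem g hb]
      exact (cosetGraph_adj _).symm
  have hrl : ∀ g : G, Sum.inr (g : G ⧸ B) ∈ S → Sum.inl (g : G ⧸ A) ∈ S := by
    intro g hg
    refine mem_of_adj_of_adj hT hS hg (trr g (g * a) hg) ?_ (cosetGraph_adj g).symm ?_
    · rw [Ne, inr_eq_inr_iff]
      simpa using ha'
    · rw [← inl_mul_mem g ha]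
      exact cosetGraph_adj _
  have hl : Sum.inl ((1 : G) : G ⧸ A) ∈ S := by
    rcases s with s | s <;> obtain ⟨g, rfl⟩ := QuotientGroup.mk_surjective s
    · exact trl g 1 hs
    · exact trl g 1 (hrl g hs)
  refine Set.eq_univ_of_forall fun v => ?_
  rcases v with v | v <;> obtain ⟨g, rfl⟩ := QuotientGroup.mk_surjective v
  · exact trl 1 g hl
  · exact hlr g (trl 1 g hl)

theorem cosetGraphAction_no_fixed_vertex {a b : G} (ha : a ∉ B) (hb : b ∉ A) :
    ¬ ∃ v, ∀ g : G, cosetGraphAction A B g v = v := by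
  rintro ⟨v | v, hv⟩ <;> obtain ⟨g, rfl⟩ := QuotientGroup.mk_surjective v
  · have := inl_eq_inl_iff.1 (hv (g * b⁻¹ * g⁻¹))
    simp [mul_assoc] at this
    exact hb this
  · have := inr_eq_inr_iff.1 (hv (g * a⁻¹ * g⁻¹))
    simp [mul_assoc] at this
    exact ha this

/-- A fixed end would make both `a` and `b`, which fix the vertices `A` and `B` respectively, fix a
common vertex `q` far along a ray. -/
theorem cosetGraphAction_no_fixed_end (hT : (cosetGraph A B).IsTree) {a b : G} (ha : a ∈ A)
    (ha' : a ∉ B) (hb : b ∈ B) (hb' : b ∉ A) :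
    ¬ ∃ e, ∀ g : G, Boundary.map (cosetGraphAction A B g) e = e := by
  rintro ⟨e, he⟩
  induction e using Quotient.inductionOn with
  | h r =>
    have fixA : ∀ a ∈ A, cosetGraphAction A B a (Sum.inl ((1 : G) : G ⧸ A)) =
        Sum.inl ((1 : G) : G ⧸ A) := fun a ha => by
      rw [cosetGraphAction_inl, mul_one, ← inl_mul_mem 1 ha, one_mul]
    have fixB : ∀ b ∈ B, cosetGraphAction A B b (Sum.inr ((1 : G) : G ⧸ B)) =
        Sum.inr ((1 : G) : G ⧸ B) := fun b hb => by
      rw [cosetGraphAction_inr, mul_one, ← inr_mul_mem 1 hb, one_mul]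
    obtain ⟨M, hM⟩ := Ray.exists_fixed_tail hT _ (fixA a ha) (Quotient.exact (he a))
    obtain ⟨N, hN⟩ := Ray.exists_fixed_tail hT _ (fixB b hb) (Quotient.exact (he b))
    replace hM := hM N
    replace hN := hN M
    rw [add_comm] at hN
    set q := r.toFun (M + N)
    have adj := cosetGraph_adj (A := A) (B := B) 1
    -- If `B` is nearer to `q` than `A`, then so is `aB`; both are neighbours of `A`, so `aB = B`,
    -- contradicting `a ∉ B`. The other case is symmetric, with `b`.
    rcases hT.dist_eq_dist_add_one_of_adj q adj with h | h
    · have hd := dist_map (cosetGraphAction A B a) hT.connected q (Sum.inr ((1 : G) : G ⧸ B))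
      have hadj := (cosetGraphAction A B a).map_rel_iff.2 adj
      rw [fixA a ha] at hadj
      rw [hM] at hd
      have := eq_of_dist_lt hT (p := q) adj hadj (by omega) (by omega)
      rw [cosetGraphAction_inr, inr_eq_inr_iff] at this
      simp at this
      exact ha' this
    · have hd := dist_map (cosetGraphAction A B b) hT.connected q (Sum.inl ((1 : G) : G ⧸ A))
      have hadj := (cosetGraphAction A B b).map_rel_iff.2 adj.symm
      rw [fixB b hb] at hadj
      rw [hN] at hd
      have := eq_of_dist_lt hT (p := q) adj.symm hadj (by omega) (by omega)
      rw [cosetGraphAction_inl, inl_eq_inl_iff] at this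
      simp at this
      exact hb' this

/-- The vertices of the ray `A, aB, abA, abaB, …` in the coset graph. -/
def axisVertex (A B : Subgroup G) (a b : G) (n : ℕ) : (G ⧸ A) ⊕ (G ⧸ B) :=
  if n % 2 = 0 then Sum.inl (((a * b) ^ (n / 2) : G) : G ⧸ A)
  else Sum.inr (((a * b) ^ (n / 2) * a : G) : G ⧸ B)

theorem axisVertex_even (a b : G) (k : ℕ) :
    axisVertex A B a b (2 * k) = Sum.inl (((a * b) ^ k : G) : G ⧸ A) := by
  simp [axisVertex]

theorem axisVertex_odd (a b : G) (k : ℕ) :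
    axisVertex A B a b (2 * k + 1) = Sum.inr (((a * b) ^ k * a : G) : G ⧸ B) := by
  rw [axisVertex, if_neg (by omega), show (2 * k + 1) / 2 = k by omega]

theorem axisVertex_adj {a b : G} (ha : a ∈ A) (hb : b ∈ B) (n : ℕ) :
    (cosetGraph A B).Adj (axisVertex A B a b n) (axisVertex A B a b (n + 1)) := by
  rcases Nat.even_or_odd' n with ⟨k, rfl | rfl⟩
  · rw [axisVertex_even, axisVertex_odd, ← inl_mul_mem _ ha]
    exact cosetGraph_adj _
  · rw [axisVertex_odd, show 2 * k + 1 + 1 = 2 * (k + 1) by ring, axisVertex_even,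
      ← inr_mul_mem _ hb, pow_succ, mul_assoc]
    exact (cosetGraph_adj _).symm

/-- A coincidence between vertices of the same kind would put a positive power of `a * b` into `A`,
or of `b * a` into `B`, against its last letter. -/
theorem LastLetter.axisVertex_injective {PA PB : Set G} (h : LastLetter A B PA PB) {a b : G}
    (ha : a ∈ A) (ha' : a ∉ B) (hb : b ∈ B) (hb' : b ∉ A) :
    Function.Injective (axisVertex A B a b) := by
  intro m n hmn
  wlog hlt : m < n generalizing m n
  · by_contra hne
    exact hne (this hmn.symm (by omega)).symm
  exfalso
  rcases Nat.even_or_odd' m with ⟨k, rfl | rfl⟩ <;> rcases Nat.even_or_odd' n with ⟨l, rfl | rfl⟩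
  · obtain ⟨d, rfl⟩ : ∃ d, l = k + (d + 1) := ⟨l - k - 1, by omega⟩
    rw [axisVertex_even, axisVertex_even, inl_eq_inl_iff, pow_add, inv_mul_cancel_left] at hmn
    exact h.notMem_left _ hmn (h.pow_mem ha ha' hb hb' d)
  · rw [axisVertex_even, axisVertex_odd] at hmn
    cases hmn
  · rw [axisVertex_even, axisVertex_odd] at hmn
    cases hmn
  · obtain ⟨d, rfl⟩ : ∃ d, l = k + (d + 1) := ⟨l - k - 1, by omega⟩
    have hconj : ((a * b) ^ k * a)⁻¹ * ((a * b) ^ (k + (d + 1)) * a) = (b * a) ^ (d + 1) := by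
      rw [inv_mul_eq_iff_eq_mul, pow_add, mul_assoc, mul_assoc, mul_right_inj]
      exact (mul_pow_mul a b (d + 1))
    rw [axisVertex_odd, axisVertex_odd, inr_eq_inr_iff, hconj] at hmn
    exact h.notMem_right _ hmn (h.symm.pow_mem hb hb' ha ha' d)

/-- The ray `A, aB, abA, abaB, …` in the coset graph of an amalgamated product. -/
def LastLetter.axisRay {PA PB : Set G} (h : LastLetter A B PA PB) {a b : G}
    (ha : a ∈ A) (ha' : a ∉ B) (hb : b ∈ B) (hb' : b ∉ A) : Ray (cosetGraph A B) where
  toFun := axisVertex A B a b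
  adj := axisVertex_adj ha hb
  inj := h.axisVertex_injective ha ha' hb hb'

/-- If `a` and `b` normalise `A ∩ B`, then whatever fixes two consecutive vertices on
`A, aB, abA, abaB, …` fixes the next one. -/
theorem axisVertex_fixed {a b : G} (ha : a ∈ A) (hb : b ∈ B)
    (hna : ∀ h ∈ A, h ∈ B → a⁻¹ * h * a ∈ B) (hnb : ∀ h ∈ A, h ∈ B → b⁻¹ * h * b ∈ A) (n : ℕ)
    (g : G) (h0 : cosetGraphAction A B g (axisVertex A B a b n) = axisVertex A B a b n)
    (h1 : cosetGraphAction A B g (axisVertex A B a b (n + 1)) = axisVertex A B a b (n + 1)) :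
    cosetGraphAction A B g (axisVertex A B a b (n + 2)) = axisVertex A B a b (n + 2) := by
  have conj : ∀ t s : G, (t * s)⁻¹ * g⁻¹ * (t * s) = s⁻¹ * (t⁻¹ * g⁻¹ * t) * s := fun t s => by
    group
  have hpow : ∀ k, (a * b) ^ (k + 1) = (a * b) ^ k * a * b := fun k => by
    rw [pow_succ, mul_assoc]
  have fixl : ∀ t : G, cosetGraphAction A B g (Sum.inl (t : G ⧸ A)) = Sum.inl (t : G ⧸ A) ↔
      t⁻¹ * g⁻¹ * t ∈ A := fun t => by
    rw [cosetGraphAction_inl, inl_eq_inl_iff, mul_inv_rev]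
  have fixr : ∀ t : G, cosetGraphAction A B g (Sum.inr (t : G ⧸ B)) = Sum.inr (t : G ⧸ B) ↔
      t⁻¹ * g⁻¹ * t ∈ B := fun t => by
    rw [cosetGraphAction_inr, inr_eq_inr_iff, mul_inv_rev]
  rcases Nat.even_or_odd' n with ⟨k, rfl | rfl⟩
  · rw [axisVertex_even, fixl] at h0
    rw [axisVertex_odd, fixr] at h1
    rw [show 2 * k + 2 = 2 * (k + 1) by ring, axisVertex_even, fixl, hpow, conj]
    refine hnb _ ?_ h1
    rw [conj]
    -- With `t = (ab)^k`, the two fixed vertices are `taA` and `taB`, so conjugation by `ta` takes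
    -- `g⁻¹` into `A ∩ B`, where `hnb` applies.
    exact A.mul_mem (A.mul_mem (A.inv_mem ha) h0) ha
  · rw [axisVertex_odd, fixr] at h0
    rw [show 2 * k + 1 + 1 = 2 * (k + 1) by ring, axisVertex_even, fixl] at h1
    rw [show 2 * k + 1 + 2 = 2 * (k + 1) + 1 by ring, axisVertex_odd, fixr, conj]
    refine hna _ h1 ?_
    rw [hpow, conj]
    exact B.mul_mem (B.mul_mem (B.inv_mem hb) h0) hb

/-- The action of an amalgamated product `G = A *_H B` on its Bass–Serre tree is weakly
acylindrical if `H` is normalised by elements of `A ∖ H` and of `B ∖ H`, but not by `A`. -/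
theorem LastLetter.isWeaklyAcylindrical {PA PB : Set G} (hL : LastLetter A B PA PB)
    (hgen : A ⊔ B = ⊤) {a b x h : G} (ha : a ∈ A) (ha' : a ∉ B) (hb : b ∈ B) (hb' : b ∉ A)
    (hna : ∀ h ∈ A, h ∈ B → a⁻¹ * h * a ∈ B) (hnb : ∀ h ∈ A, h ∈ B → b⁻¹ * h * b ∈ A)
    (hx : x ∈ A) (hhA : h ∈ A) (hhB : h ∈ B) (hxh : x⁻¹ * h * x ∉ B) :
    IsWeaklyAcylindrical (cosetGraphAction A B) where
  isTree := hL.isTree hgen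
  withoutInversions := cosetGraphAction_withoutInversions A B
  minimal := cosetGraphAction_isMinimal (hL.isTree hgen) ha ha' hb hb'
  no_fixed_vertex := cosetGraphAction_no_fixed_vertex ha' hb'
  no_fixed_end := cosetGraphAction_no_fixed_end (hL.isTree hgen) ha ha' hb hb'
  not_twoTransitive := by
    have hx' : x ∉ B := fun hx' => hxh (B.mul_mem (B.mul_mem (B.inv_mem hx') hhB) hx')
    let r : Ray (cosetGraph A B) := hL.axisRay ha ha' hb hb'
    let s : Ray (cosetGraph A B) := hL.axisRay hx hx' hb hb'
    have key : ∀ g : G, ¬ (r.map (cosetGraphAction A B g)).Cofinal s := by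
      rintro g ⟨m, n, hmn⟩
      change ∀ k, cosetGraphAction A B g (axisVertex A B a b (m + k)) =
        axisVertex A B x b (n + k) at hmn
      -- This exponent places `tB`, `tA`, `txB` at positions `2n+1`, `2n+2`, `2n+3` of `s`, beyond
      -- position `n` whatever its parity. The element `e` fixes the first two and moves the third.
      let t := (x * b) ^ (n + 1)
      let e := t * h * t⁻¹
      have tr : ∀ k, cosetGraphAction A B (g⁻¹ * e * g) (axisVertex A B a b (m + k)) =
          axisVertex A B a b (m + k) ↔ cosetGraphAction A B e (axisVertex A B x b (n + k)) =
          axisVertex A B x b (n + k) := by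
        intro k
        rw [← hmn k]
        generalize axisVertex A B a b (m + k) = u
        change (g⁻¹ * e * g) • u = u ↔ e • (g • u) = g • u
        rw [mul_smul, mul_smul, inv_smul_eq_iff]
      have h0 := (tr (n + 1)).2 (by
        rw [show n + (n + 1) = 2 * n + 1 by ring, axisVertex_odd, ← inr_mul_mem _ hb, mul_assoc,
          ← pow_succ, cosetGraphAction_inr]
        simpa [e, t, mul_assoc] using inr_mul_mem (A := A) t hhB)
      have h1 := (tr (n + 2)).2 (by
        rw [show n + (n + 2) = 2 * (n + 1) by ring, axisVertex_even, cosetGraphAction_inl]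
        simpa [e, t, mul_assoc] using inl_mul_mem (B := B) t hhA)
      have h2 := (tr (n + 3)).1 (axisVertex_fixed ha hb hna hnb (m + (n + 1)) _ h0 h1)
      rw [show n + (n + 3) = 2 * (n + 1) + 1 by ring, axisVertex_odd, cosetGraphAction_inr,
        inr_eq_inr_iff] at h2
      refine hxh ?_
      rw [← B.inv_mem_iff]
      convert h2 using 1
      simp [e, t, mul_assoc]
    intro htr
    have hne : (Quotient.mk _ r : Boundary (cosetGraph A B)) ≠ Quotient.mk _ s := fun heq => by
      obtain ⟨m, n, hmn⟩ := Quotient.exact heq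
      refine key 1 ⟨m, n, fun k => ?_⟩
      rw [map_one]
      exact hmn k
    -- Some element would have to interchange the two ends.
    obtain ⟨g, hg, -⟩ := htr _ _ _ _ hne hne.symm
    exact key g (Quotient.exact hg)

end CosetGraph

end TreeAction

/-! ### Last letters from normal forms in amalgamated products. -/

namespace Monoid.PushoutI

open NormalWord

variable {ι : Type*} {G : ι → Type*} {H : Type*} [∀ i, Group (G i)] [Group H]
  {φ : ∀ i, H →* G i}

section

variable [DecidableEq ι] [∀ i, DecidableEq (G i)]

/-- The elements of an amalgamated product whose normal form, read from right to left, starts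
with a letter from the `i`-th factor. -/
def endsWith (d : Transversal φ) (i : ι) : Set (PushoutI φ) :=
  {g | (g⁻¹ • (NormalWord.empty : NormalWord d)).fstIdx = some i}

/-- Normal words carry a left action, so the last letter of `g` is seen as the first letter of
`g⁻¹`: appending `a` to `g` prepends `a⁻¹` to the word of `g⁻¹`. -/
theorem mul_of_mem_endsWith {d : Transversal φ} {i : ι} {g : PushoutI φ}
    (hg : g ∉ endsWith d i) {a : G i} (ha : a ∉ (φ i).range) : g * of i a ∈ endsWith d i := by
  change ((g * of i a)⁻¹ • (NormalWord.empty : NormalWord d)).fstIdx = some i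
  rw [mul_inv_rev, mul_smul, ← map_inv,
    ← cons_eq_smul a⁻¹ _ hg fun h => ha (by simpa using inv_mem h)]
  simp [NormalWord.cons, CoprodI.Word.fstIdx, CoprodI.Word.cons]

theorem of_notMem_endsWith {d : Transversal φ} {i j : ι} (hij : i ≠ j) (a : G i) :
    of i a ∉ endsWith d j := by
  by_cases ha : a ∈ (φ i).range
  · obtain ⟨h, rfl⟩ := ha
    change ¬ ((of i (φ i h))⁻¹ • (NormalWord.empty : NormalWord d)).fstIdx = some j
    rw [of_apply_eq_base, ← map_inv, base_smul_def]
    simp [CoprodI.Word.fstIdx, NormalWord.empty, CoprodI.Word.empty]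
  · have h1 : (1 : PushoutI φ) ∉ endsWith d i := by
      change ¬ ((1 : PushoutI φ)⁻¹ • (NormalWord.empty : NormalWord d)).fstIdx = some i
      rw [inv_one, one_smul]
      simp [CoprodI.Word.fstIdx, NormalWord.empty, CoprodI.Word.empty]
    have h2 := mul_of_mem_endsWith h1 ha
    rw [one_mul] at h2
    intro h3
    exact hij (Option.some.inj (h2.symm.trans h3))

theorem lastLetter_endsWith (d : Transversal φ) {i j : ι} (hij : i ≠ j) :
    TreeAction.LastLetter (of (φ := φ) i).range (of (φ := φ) j).range
      (endsWith d i) (endsWith d j) where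
  disj g hi hj := hij (Option.some.inj (hi.symm.trans hj))
  notMem_left := by
    rintro _ ⟨a, rfl⟩
    exact of_notMem_endsWith hij a
  notMem_right := by
    rintro _ ⟨a, rfl⟩
    exact of_notMem_endsWith hij.symm a
  mul_left := by
    rintro g hg _ ⟨a, rfl⟩ ha
    refine mul_of_mem_endsWith hg ?_
    rintro ⟨h, rfl⟩
    exact ha ⟨φ j h, by rw [of_apply_eq_base, of_apply_eq_base]⟩
  mul_right := by
    rintro g hg _ ⟨a, rfl⟩ ha
    refine mul_of_mem_endsWith hg ?_
    rintro ⟨h, rfl⟩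
    exact ha ⟨φ i h, by rw [of_apply_eq_base, of_apply_eq_base]⟩

end

theorem of_mem_range_of_iff (hφ : ∀ i, Function.Injective (φ i)) {i j : ι} (hij : i ≠ j)
    (a : G i) : of (φ := φ) i a ∈ (of (φ := φ) j).range ↔ a ∈ (φ i).range := by
  constructor
  · intro h
    have h' : of (φ := φ) i a ∈ (base φ).range := by
      rw [← inf_of_range_eq_base_range hφ hij]
      exact ⟨⟨a, rfl⟩, h⟩
    obtain ⟨k, hk⟩ := h'
    rw [← of_apply_eq_base φ i] at hk
    exact ⟨k, of_injective hφ i hk⟩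
  · rintro ⟨h, rfl⟩
    exact ⟨φ j h, by rw [of_apply_eq_base, of_apply_eq_base]⟩

end Monoid.PushoutI

/-! ### Freeness of `𝒮` and the subgroup `H`, through the reading action. -/

namespace Camm

/-- The fibrewise permutation of `FreeGroup I × ℤ × ℤ` which sends `(u, l, σ j)` to
`(c l j * u, l, j)` for `j ≠ 0` and fixes `(u, l, 0)`. -/
def relabel {I : Type*} (σ : Equiv.Perm ZStar) (c : ℤ → ZStar → FreeGroup I) :
    Equiv.Perm (FreeGroup I × ℤ × ℤ) where
  toFun p := if h : p.2.2 = 0 then p else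
    (c p.2.1 (σ.symm ⟨p.2.2, h⟩) * p.1, p.2.1, σ.symm ⟨p.2.2, h⟩)
  invFun p := if h : p.2.2 = 0 then p else
    ((c p.2.1 ⟨p.2.2, h⟩)⁻¹ * p.1, p.2.1, σ ⟨p.2.2, h⟩)
  left_inv := by
    rintro ⟨u, l, k⟩
    by_cases h : k = 0
    · simp [h]
    · simp [h, (σ.symm ⟨k, h⟩).2]
  right_inv := by
    rintro ⟨u, l, k⟩
    by_cases h : k = 0
    · simp [h]
    · simp [h, (σ ⟨k, h⟩).2]

section

variable {I : Type*} (σ : Equiv.Perm ZStar) (c : ℤ → ZStar → FreeGroup I)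

theorem relabel_zero (u : FreeGroup I) (l : ℤ) : relabel σ c (u, l, 0) = (u, l, 0) := by
  simp [relabel]

theorem relabel_inv_zero (u : FreeGroup I) (l : ℤ) :
    (relabel σ c)⁻¹ (u, l, 0) = (u, l, 0) := by
  rw [Equiv.Perm.inv_eq_iff_eq, relabel_zero]

theorem relabel_apply (u : FreeGroup I) (l : ℤ) (j : ZStar) :
    relabel σ c (u, l, σ j) = (c l j * u, l, (j : ℤ)) := by
  simp [relabel, (σ j).2]

theorem relabel_inv_apply (u : FreeGroup I) (l : ℤ) (j : ZStar) :
    (relabel σ c)⁻¹ (u, l, j) = ((c l j)⁻¹ * u, l, (σ j : ℤ)) := by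
  rw [Equiv.Perm.inv_eq_iff_eq, relabel_apply, mul_inv_cancel_left]

end

/-- The permutation `(u, l, k) ↦ (u, l, k - 1)`. -/
def shift (I : Type*) : Equiv.Perm (FreeGroup I × ℤ × ℤ) :=
  Equiv.prodCongr (Equiv.refl _) (Equiv.prodCongr (Equiv.refl _) (Equiv.subRight 1))

theorem shift_zpow_apply {I : Type*} (n : ℤ) (u : FreeGroup I) (l k : ℤ) :
    (shift I ^ n) (u, l, k) = (u, l, k - n) := by
  have h1 : ∀ u l k, shift I (u, l, k) = (u, l, k - 1) := fun _ _ _ => rfl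
  induction n generalizing k with
  | zero => simp
  | succ n ih => rw [zpow_add_one, Equiv.Perm.mul_apply, h1, ih]; congr 2; ring
  | pred n ih =>
    have h2 : (shift I)⁻¹ (u, l, k) = (u, l, k + 1) := by
      rw [Equiv.Perm.inv_eq_iff_eq, h1]; simp
    rw [zpow_sub_one, Equiv.Perm.mul_apply, h2, ih]; congr 2; ring

/-- The permutation which sends `(u, l, 0)` to `(u, l + 1, 0)` and fixes everything else. -/
def climb (I : Type*) : Equiv.Perm (FreeGroup I × ℤ × ℤ) where
  toFun p := if p.2.2 = 0 then (p.1, p.2.1 + 1, 0) else p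
  invFun p := if p.2.2 = 0 then (p.1, p.2.1 - 1, 0) else p
  left_inv := by
    rintro ⟨u, l, k⟩
    by_cases h : k = 0 <;> simp [h]
  right_inv := by
    rintro ⟨u, l, k⟩
    by_cases h : k = 0 <;> simp [h]

/-- The labels of the elements of `𝒮`. -/
abbrev Label : Type := (ℤ × ZStar) ⊕ (ℤ × ZStar)

/-- The element of `𝒮` with a given label. -/
def gen (ρ θ : Equiv.Perm ZStar) : Label → F₃ :=
  Sum.elim (fun p => v ρ p.1 p.2) (fun p => w θ p.1 p.2)

/-- The action of `F₃` on the Schreier graph of `H`, with a coordinate in the free group on the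
labels that records the element of `H` that is read. -/
def reading (ρ θ : Equiv.Perm ZStar) : F₃ →* Equiv.Perm (FreeGroup Label × ℤ × ℤ) :=
  FreeGroup.lift ![shift Label,
    relabel ρ (fun l j => FreeGroup.of (Sum.inl (l, j))) * shift Label *
      (relabel ρ (fun l j => FreeGroup.of (Sum.inl (l, j))))⁻¹,
    relabel θ (fun l j => FreeGroup.of (Sum.inr (l, j))) * climb Label *
      (relabel ρ (fun l j => FreeGroup.of (Sum.inl (l, j))))⁻¹]

section

variable (ρ θ : Equiv.Perm ZStar)

theorem reading_x_zpow (n : ℤ) (u : FreeGroup Label) (l k : ℤ) :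
    reading ρ θ (x ^ n) (u, l, k) = (u, l, k - n) := by
  rw [map_zpow, show reading ρ θ x = shift Label from by simp [reading, x], shift_zpow_apply]

theorem reading_y_zpow (n : ℤ) :
    reading ρ θ (y ^ n) = relabel ρ (fun l j => FreeGroup.of (Sum.inl (l, j))) * shift Label ^ n *
      (relabel ρ (fun l j => FreeGroup.of (Sum.inl (l, j))))⁻¹ := by
  rw [map_zpow, ← conj_zpow]
  simp [reading, y]

theorem reading_y_zpow_zero (u : FreeGroup Label) (l : ℤ) (j : ZStar) :
    reading ρ θ (y ^ (-(ρ j : ℤ))) (u, l, 0) =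
      (FreeGroup.of (Sum.inl (l, j)) * u, l, (j : ℤ)) := by
  rw [reading_y_zpow, Equiv.Perm.mul_apply, Equiv.Perm.mul_apply, relabel_inv_zero,
    shift_zpow_apply, zero_sub, neg_neg, relabel_apply]

theorem reading_z :
    reading ρ θ z = relabel θ (fun l j => FreeGroup.of (Sum.inr (l, j))) * climb Label *
      (relabel ρ (fun l j => FreeGroup.of (Sum.inl (l, j))))⁻¹ := by
  simp [reading, z]

theorem reading_z_zero (u : FreeGroup Label) (l : ℤ) :
    reading ρ θ z (u, l, 0) = (u, l + 1, 0) := by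
  rw [reading_z, Equiv.Perm.mul_apply, Equiv.Perm.mul_apply, relabel_inv_zero]
  simp [climb, relabel_zero]

theorem reading_z_zpow_zero (n : ℤ) (u : FreeGroup Label) (l : ℤ) :
    reading ρ θ (z ^ n) (u, l, 0) = (u, l + n, 0) := by
  rw [map_zpow]
  induction n generalizing l with
  | zero => simp
  | succ n ih => rw [zpow_add_one, Equiv.Perm.mul_apply, reading_z_zero, ih]; congr 2; ring
  | pred n ih =>
    have h2 : (reading ρ θ z)⁻¹ (u, l, 0) = (u, l - 1, 0) := by
      rw [Equiv.Perm.inv_eq_iff_eq, reading_z_zero, sub_add_cancel]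
    rw [zpow_sub_one, Equiv.Perm.mul_apply, h2, ih]; congr 2; ring

theorem reading_v_base (u : FreeGroup Label) (l : ℤ) (j : ZStar) :
    reading ρ θ (x ^ (j : ℤ) * y ^ (-(ρ j : ℤ))) (u, l, 0) =
      (FreeGroup.of (Sum.inl (l, j)) * u, l, 0) := by
  rw [map_mul, Equiv.Perm.mul_apply, reading_y_zpow_zero, reading_x_zpow, sub_self]

/-- The final relabelling by `ρ` in the power of `y` is cancelled by the initial one in `z`. What
remains is at position `θ j ≠ 0`, where `climb` is trivial, so `z` only contributes the relabelling
by `θ`, which records the label. -/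
theorem reading_w_base (u : FreeGroup Label) (l : ℤ) (j : ZStar) :
    reading ρ θ (x ^ (j : ℤ) * z * y ^ (-(θ j : ℤ))) (u, l, 0) =
      (FreeGroup.of (Sum.inr (l, j)) * u, l, 0) := by
  have hz : climb Label (u, l, (θ j : ℤ)) = (u, l, (θ j : ℤ)) := by
    simp [climb, (θ j).2]
  rw [map_mul, map_mul, Equiv.Perm.mul_apply, Equiv.Perm.mul_apply, reading_y_zpow, reading_z,
    Equiv.Perm.mul_apply, Equiv.Perm.mul_apply, Equiv.Perm.mul_apply, Equiv.Perm.mul_apply,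
    ← Equiv.Perm.mul_apply (_)⁻¹, inv_mul_cancel, Equiv.Perm.one_apply, relabel_inv_zero, shift_zpow_apply, zero_sub, neg_neg,
    hz, relabel_apply, reading_x_zpow, sub_self]

theorem reading_conj {a : F₃} {s : FreeGroup Label} {l : ℤ}
    (ha : ∀ u, reading ρ θ a (u, l, 0) = (s * u, l, 0)) (u : FreeGroup Label) :
    reading ρ θ ((z ^ l)⁻¹ * a * z ^ l) (u, 0, 0) = (s * u, 0, 0) := by
  rw [← zpow_neg, map_mul, map_mul, Equiv.Perm.mul_apply, Equiv.Perm.mul_apply,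
    reading_z_zpow_zero, zero_add, ha, reading_z_zpow_zero, add_neg_cancel]

theorem reading_gen (i : Label) (u : FreeGroup Label) :
    reading ρ θ (gen ρ θ i) (u, 0, 0) = (FreeGroup.of i * u, 0, 0) := by
  rcases i with ⟨l, j⟩ | ⟨l, j⟩
  · exact reading_conj ρ θ (fun u => reading_v_base ρ θ u l j) u
  · exact reading_conj ρ θ (fun u => reading_w_base ρ θ u l j) u

theorem reading_lift_gen (g : FreeGroup Label) (u : FreeGroup Label) :
    reading ρ θ (FreeGroup.lift (gen ρ θ) g) (u, 0, 0) = (g * u, 0, 0) := by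
  induction g using FreeGroup.induction_on generalizing u with
  | C1 => simp
  | of i => rw [FreeGroup.lift_apply_of, reading_gen]
  | inv_of i ih =>
    rw [map_inv, map_inv, Equiv.Perm.inv_eq_iff_eq, ih, mul_inv_cancel_left]
  | mul g h ihg ihh => rw [map_mul, map_mul, Equiv.Perm.mul_apply, ihh, ihg, mul_assoc]

/-- Acting on `(1, 0, 0)` recovers the word in the labels as the first coordinate. -/
theorem lift_gen_injective : Function.Injective (FreeGroup.lift (gen ρ θ)) := by
  intro g h hgh
  have := reading_lift_gen ρ θ g 1
  rw [hgh, reading_lift_gen] at this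
  simpa using (congrArg Prod.fst this).symm

theorem gen_injective : Function.Injective (gen ρ θ) := fun i j h =>
  FreeGroup.of_injective (lift_gen_injective ρ θ (by simpa using h))

theorem range_gen : Set.range (gen ρ θ) = genSet ρ θ := by
  ext a
  constructor
  · rintro ⟨⟨l, j⟩ | ⟨l, j⟩, rfl⟩
    exacts [Or.inl ⟨l, j, rfl⟩, Or.inr ⟨l, j, rfl⟩]
  · rintro (⟨l, j, rfl⟩ | ⟨l, j, rfl⟩)
    exacts [⟨Sum.inl (l, j), rfl⟩, ⟨Sum.inr (l, j), rfl⟩]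

/-- The set `𝒮` is a free basis of the subgroup it generates. -/
theorem lift_genSet_injective :
    Function.Injective (FreeGroup.lift (fun s : genSet ρ θ => (s : F₃))) := by
  let e : Label ≃ genSet ρ θ :=
    (Equiv.ofInjective _ (gen_injective ρ θ)).trans (Equiv.setCongr (range_gen ρ θ))
  have h : (FreeGroup.lift (fun s : genSet ρ θ => (s : F₃))).comp
      (FreeGroup.freeGroupCongr e).toMonoidHom = FreeGroup.lift (gen ρ θ) := by
    ext i
    simp [e]
  have hinj := lift_gen_injective ρ θ
  rw [← h, MonoidHom.coe_comp] at hinj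
  exact hinj.of_comp_right (FreeGroup.freeGroupCongr e).surjective

theorem range_lift_genSet :
    (FreeGroup.lift (fun s : genSet ρ θ => (s : F₃))).range = Subgroup.closure (genSet ρ θ) := by
  rw [FreeGroup.range_lift_eq_closure, Subtype.range_coe]

/-- This is the test for non-membership in `H`: an element that changes an integer coordinate of the
base point is outside. -/
theorem reading_of_mem_closure {g : F₃} (hg : g ∈ Subgroup.closure (genSet ρ θ))
    (u : FreeGroup Label) : ∃ u', reading ρ θ g (u, 0, 0) = (u', 0, 0) := by
  rw [← range_gen, ← FreeGroup.range_lift_eq_closure] at hg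
  obtain ⟨k, rfl⟩ := hg
  exact ⟨_, reading_lift_gen ρ θ k u⟩

theorem z_notMem_closure : z ∉ Subgroup.closure (genSet ρ θ) := fun h => by
  obtain ⟨u, hu⟩ := reading_of_mem_closure ρ θ h 1
  rw [reading_z_zero] at hu
  simp at hu

theorem conj_z_mem_closure {g : F₃} (hg : g ∈ Subgroup.closure (genSet ρ θ)) :
    z⁻¹ * g * z ∈ Subgroup.closure (genSet ρ θ) := by
  induction hg using Subgroup.closure_induction with
  | mem g hg =>
    apply Subgroup.subset_closure
    rcases hg with ⟨l, j, rfl⟩ | ⟨l, j, rfl⟩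
    · exact Or.inl ⟨l + 1, j, by simp only [v]; group⟩
    · exact Or.inr ⟨l + 1, j, by simp only [w]; group⟩
  | one => simp
  | mul g h _ _ ihg ihh =>
    convert Subgroup.mul_mem _ ihg ihh using 1
    group
  | inv g _ ih =>
    convert Subgroup.inv_mem _ ih using 1
    group

/-- The subgroup generated by `𝒮` is not normalised by `x`. -/
theorem exists_conj_x_notMem_closure : ∃ g ∈ Subgroup.closure (genSet ρ θ),
    x⁻¹ * g * x ∉ Subgroup.closure (genSet ρ θ) := by
  -- Since `x` moves the base point to position `-1`, `j` is chosen so that the power of `y` in `w θ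
  -- 0 j` brings position `-1` back to `0`. There `z` raises the level from `0` to `1`, and powers
  -- of `x` cannot undo this.
  let m : ZStar := ⟨-1, by norm_num⟩
  let j : ZStar := θ.symm ⟨-(ρ m : ℤ), neg_ne_zero.2 (ρ m).2⟩
  have hj : -(θ j : ℤ) = ρ m := by simp [j]
  refine ⟨w θ 0 j, Subgroup.subset_closure (Or.inr ⟨0, j, rfl⟩), fun h => ?_⟩
  obtain ⟨u, hu⟩ := reading_of_mem_closure ρ θ h 1
  have hw : x⁻¹ * w θ 0 j * x = x ^ (-1 : ℤ) * x ^ (j : ℤ) * z * y ^ ((ρ m : ℤ)) * x ^ (1 : ℤ) := by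
    simp only [w, hj]
    group
  have hx : reading ρ θ (x ^ (1 : ℤ)) (1, 0, 0) = (1, 0, (m : ℤ)) := reading_x_zpow ρ θ 1 1 0 0
  rw [hw, map_mul, map_mul, map_mul, map_mul, Equiv.Perm.mul_apply, Equiv.Perm.mul_apply,
    Equiv.Perm.mul_apply, Equiv.Perm.mul_apply, hx, reading_y_zpow,
    Equiv.Perm.mul_apply, Equiv.Perm.mul_apply, relabel_inv_apply, shift_zpow_apply, sub_self,
    relabel_zero, reading_z_zero, reading_x_zpow, reading_x_zpow] at hu
  simp at hu

end

/-! ### The two factors of `G` and their intersection. -/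

section

variable {ρ θ ρ' θ' : Equiv.Perm ZStar} (ι : genSet ρ θ ≃ genSet ρ' θ')

theorem legs_one : legs ι 1 = (FreeGroup.lift (fun s : genSet ρ' θ' => (s : F₃))).comp
    (FreeGroup.freeGroupCongr ι).toMonoidHom := by
  ext s
  simp [legs]

theorem legs_injective (i : Fin 2) : Function.Injective (legs ι i) := by
  fin_cases i
  · exact lift_genSet_injective ρ θ
  · change Function.Injective (legs ι 1)
    rw [legs_one, MonoidHom.coe_comp]
    exact (lift_genSet_injective ρ' θ').comp (FreeGroup.freeGroupCongr ι).injective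

theorem range_legs_zero : (legs ι 0).range = Subgroup.closure (genSet ρ θ) :=
  range_lift_genSet ρ θ

theorem range_legs_one : (legs ι 1).range = Subgroup.closure (genSet ρ' θ') := by
  rw [legs_one, MonoidHom.range_comp, MonoidHom.range_eq_top.2, ← MonoidHom.range_eq_map,
    range_lift_genSet]
  exact (FreeGroup.freeGroupCongr ι).surjective

theorem factor_sup_factor : factor ι 0 ⊔ factor ι 1 = ⊤ := by
  refine eq_top_iff.2 fun g _ => ?_
  have hof : ∀ (i : Fin 2) (a : F₃),
      Monoid.PushoutI.of (G := fun _ : Fin 2 => F₃) (φ := legs ι) i a ∈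
        factor ι 0 ⊔ factor ι 1 := by
    intro i a
    fin_cases i
    · exact Subgroup.mem_sup_left ⟨a, rfl⟩
    · exact Subgroup.mem_sup_right ⟨a, rfl⟩
  induction g using Monoid.PushoutI.induction_on with
  | of i a => exact hof i a
  | base h =>
    rw [← Monoid.PushoutI.of_apply_eq_base (legs ι) 0]
    exact hof 0 _
  | mul g h ihg ihh => exact Subgroup.mul_mem _ (ihg trivial) (ihh trivial)

theorem of_zero_mem_factor_one (a : F₃) :
    Monoid.PushoutI.of (G := fun _ : Fin 2 => F₃) (φ := legs ι) 0 a ∈ factor ι 1 ↔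
      a ∈ Subgroup.closure (genSet ρ θ) := by
  rw [← range_legs_zero ι]
  exact Monoid.PushoutI.of_mem_range_of_iff (legs_injective ι) zero_ne_one a

theorem of_one_mem_factor_zero (a : F₃) :
    Monoid.PushoutI.of (G := fun _ : Fin 2 => F₃) (φ := legs ι) 1 a ∈ factor ι 0 ↔
      a ∈ Subgroup.closure (genSet ρ' θ') := by
  rw [← range_legs_one ι]
  exact Monoid.PushoutI.of_mem_range_of_iff (legs_injective ι) one_ne_zero a

end

end Camm

theorem mainTheorem2 (ρ θ ρ' θ' : Equiv.Perm Camm.ZStar)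
    (ι : Camm.genSet ρ θ ≃ Camm.genSet ρ' θ') :
    TreeAction.IsWeaklyAcylindrical (Camm.bassSerreAction ι) := by
  classical
  obtain ⟨d⟩ := Monoid.PushoutI.NormalWord.transversal_nonempty (Camm.legs ι) (Camm.legs_injective ι)
  obtain ⟨h, hh, hxh⟩ := Camm.exists_conj_x_notMem_closure ρ θ
  let of₀ := Monoid.PushoutI.of (G := fun _ : Fin 2 => Camm.F₃) (φ := Camm.legs ι) 0
  let of₁ := Monoid.PushoutI.of (G := fun _ : Fin 2 => Camm.F₃) (φ := Camm.legs ι) 1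
  have hL : TreeAction.LastLetter (Camm.factor ι 0) (Camm.factor ι 1) _ _ :=
    Monoid.PushoutI.lastLetter_endsWith d zero_ne_one
  refine hL.isWeaklyAcylindrical (Camm.factor_sup_factor ι)
    (a := of₀ Camm.z) (b := of₁ Camm.z) (x := of₀ Camm.x) (h := of₀ h)
    ⟨_, rfl⟩ ?_ ⟨_, rfl⟩ ?_ ?_ ?_ ⟨_, rfl⟩ ⟨_, rfl⟩ ?_ ?_
  · exact fun hz => Camm.z_notMem_closure ρ θ ((Camm.of_zero_mem_factor_one ι _).1 hz)
  · exact fun hz => Camm.z_notMem_closure ρ' θ' ((Camm.of_one_mem_factor_zero ι _).1 hz)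
  · rintro _ ⟨g, rfl⟩ hg
    have := (Camm.of_zero_mem_factor_one ι _).2
      (Camm.conj_z_mem_closure ρ θ ((Camm.of_zero_mem_factor_one ι _).1 hg))
    rwa [map_mul, map_mul, map_inv] at this
  · rintro _ hg ⟨g, rfl⟩
    have := (Camm.of_one_mem_factor_zero ι _).2
      (Camm.conj_z_mem_closure ρ' θ' ((Camm.of_one_mem_factor_zero ι _).1 hg))
    rwa [map_mul, map_mul, map_inv] at this
  · exact (Camm.of_zero_mem_factor_one ι _).2 hh
  · intro hx
    refine hxh ((Camm.of_zero_mem_factor_one ι _).1 ?_)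
    rwa [map_mul, map_mul, map_inv]
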